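/- Let $\Sigma=(A,B,C)$ be a linear system $\dot x=Ax+Bu,\ y=Cx$ with complex matrices $A,B,C$ of sizes $N\times N$, $N\times m$, $p\times N$, let $G(s)=C(sI-A)^{-1}B$ be its transfer function, and let $$P_\Sigma(K)=\det\bigl(sI-(A+BKC)\bigr)\in\mathbb C[s],\qquad K\in\mathrm{Mat}_{m\times p}(\mathbb C),$$ be its pole placement map. Put $V=\mathbb C^{m+p}$, and for $K\in\mathrm{Mat}_{m\times p}(\mathbb C)$ let $\kappa(K)\in\wedge^pV$ be the exterior product of the columns of $\begin{pmatrix}K\\ I_p\end{pmatrix}$, that is, the Plücker vector of its column space. The pole placement map is a \emph{generalized Wronski map} $\pi_Z$ with center $Z\subset\wedge^pV$ (a linear subspace) if there is an injective linear map $\varphi\colon(\wedge^pV)/Z\to\mathbb C[s]$ such that for every $K$ the polynomials $\varphi(\kappa(K)+Z)$ and $P_\Sigma(K)$ agree up to a nonzero scalar. It is a \emph{self-adjoint} generalized Wronski map if this holds for some $Z$ such that, in addition, $\dim V=2p$ (that is, $m=p$) and $Z\supset\theta\wedge(\wedge^{p-2}V)$ for some symplectic form $\omega$ on $V$, where $\theta\in\wedge^2V$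 is the dual form of $\omega$ ($\theta=\sum_i e_i\wedge f_i$ in a Darboux basis), and $\wedge^{p-2}V=0$ when $p<2$. A system is \emph{symmetric} if $p=m$ and its transfer function satisfies $G(s)^T=G(s)$. Systems $(A,B,C)$ and $(\widetilde A,\widetilde B,\widetilde C)$ are \emph{state feedback equivalent} if $$\widetilde A=L^{-1}(A+BQT^{-1}C)L,\qquad \widetilde B=L^{-1}BW,\qquad \widetilde C=T^{-1}CL$$ for some matrices $L,W,T,Q$ (of sizes $N\times N$, $m\times m$, $p\times p$, $m\times p$) with $L,W,T$ invertible. If the pole placement map of $\Sigma$ is a self-adjoint generalized Wronski map, then $\Sigma$ is state feedback equivalent to a symmetric system. -/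

import Mathlib

open Polynomial

noncomputable section

/-- A state-space realization `Σ = (A, B, C)` of a (strictly proper) linear system
`x' = A x + B u`, `y = C x` with `N` states, `m` inputs and `p` outputs over `ℂ`. -/
structure LinearSystem (N m p : ℕ) where
  A : Matrix (Fin N) (Fin N) ℂ
  B : Matrix (Fin N) (Fin m) ℂ
  C : Matrix (Fin p) (Fin N) ℂ

namespace LinearSystem

variable {N m p : ℕ}

/-- The transfer function `G(s) = C (s I - A)⁻¹ B`, a `p × m` matrix of rational functions in `s`.
(The determinant of `s I - A` is the characteristic polynomial of `A`, which is not zero, so that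
the inverse is a genuine inverse over `ℂ(s)`.) -/
def transferFunction (S : LinearSystem N m p) : Matrix (Fin p) (Fin m) (RatFunc ℂ) :=
  S.C.map (algebraMap ℂ (RatFunc ℂ)) *
    (Matrix.scalar (Fin N) (RatFunc.X : RatFunc ℂ) - S.A.map (algebraMap ℂ (RatFunc ℂ)))⁻¹ *
    S.B.map (algebraMap ℂ (RatFunc ℂ))

/-- A linear system is symmetric if `p = m` and its transfer function satisfies `G(s)ᵀ = G(s)`. -/
def IsSymmetric (S : LinearSystem N m p) : Prop :=
  ∃ h : p = m, ∀ (i : Fin p) (j : Fin m),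
    S.transferFunction i j = S.transferFunction (Fin.cast h.symm j) (Fin.cast h i)

/-- State feedback equivalence of `(A, B, C)` and `(A', B', C')`:
`A' = L⁻¹ (A + B Q T⁻¹ C) L`, `B' = L⁻¹ B W`, `C' = T⁻¹ C L`, with `L`, `W`, `T` invertible. -/
def StateFeedbackEquivalent (S S' : LinearSystem N m p) : Prop :=
  ∃ (L : Matrix (Fin N) (Fin N) ℂ) (W : Matrix (Fin m) (Fin m) ℂ)
    (T : Matrix (Fin p) (Fin p) ℂ) (Q : Matrix (Fin m) (Fin p) ℂ),
    IsUnit L ∧ IsUnit W ∧ IsUnit T ∧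
      S'.A = L⁻¹ * (S.A + S.B * Q * T⁻¹ * S.C) * L ∧
      S'.B = L⁻¹ * S.B * W ∧
      S'.C = T⁻¹ * S.C * L

/-- The pole placement map `K ↦ P_Σ(K) = det (s I - (A + B K C))` on constant output feedback
laws `u = K y`. -/
def polePlacementMap (S : LinearSystem N m p) (K : Matrix (Fin m) (Fin p) ℂ) : ℂ[X] :=
  (S.A + S.B * K * S.C).charpoly

end LinearSystem

/-- For the injection `Mat_{m × p} → Gr_p ℂ^{m+p}` sending `K` to the column space of the block
matrix with `K` above `I_p`: the Plücker coordinates of that column space, that is, the exterior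
product of the `p` columns in `⋀^p ℂ^{m+p}`. The first `m` coordinates of `ℂ^{m+p}` are indexed by
`Fin m` and the last `p` by `Fin p`. -/
def feedbackPlucker {m p : ℕ} (K : Matrix (Fin m) (Fin p) ℂ) :
    ⋀[ℂ]^p (Fin m ⊕ Fin p → ℂ) :=
  exteriorPower.ιMulti ℂ p
    (fun j : Fin p => Sum.elim (fun i => K i j) (fun i => (1 : Matrix (Fin p) (Fin p) ℂ) i j))

/-- The map `f`, from `m × p` matrices to polynomials up to nonzero scalars, is the generalized
Wronski map `π_Z`: the space `(⋀^p ℂ^{m+p}) / Z` is identified, by an injective linear map `φ`,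
with a space of polynomials in such a way that, at every point of the Grassmannian
`Gr_p ℂ^{m+p}` coming from a matrix `K`, the projection from the center `ℙ(Z)` is defined
(since `f K ≠ 0` for the maps of interest) and its value is the class of `f K` in the
projective space of polynomials. -/
def IsGeneralizedWronskiMap {m p : ℕ} (f : Matrix (Fin m) (Fin p) ℂ → ℂ[X])
    (Z : Submodule ℂ (⋀[ℂ]^p (Fin m ⊕ Fin p → ℂ))) : Prop :=
  ∃ φ : ((⋀[ℂ]^p (Fin m ⊕ Fin p → ℂ)) ⧸ Z) →ₗ[ℂ] ℂ[X], Function.Injective φ ∧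
    ∀ K : Matrix (Fin m) (Fin p) ℂ, ∃ c : ℂ, c ≠ 0 ∧ φ (Z.mkQ (feedbackPlucker K)) = c • f K

/-- The element `θ` of `⋀² V` dual to a symplectic form `ω` on `V`, where `b` is any basis of `V`:
`θ = ½ ∑ i, b*ᵢ ∧ bᵢ`, where `ω (b*ᵢ, bⱼ) = δᵢⱼ`. It does not depend on the basis, and for a Darboux
basis (`ω (eᵢ, fᵢ) = 1`) it is `∑ i, eᵢ ∧ fᵢ`. -/
def dualTwoForm {ι V : Type*} [Fintype ι] [DecidableEq ι] [AddCommGroup V] [Module ℂ V]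
    (b : Module.Basis ι ℂ V) (ω : LinearMap.BilinForm ℂ V) (hω : ω.Nondegenerate) :
    ExteriorAlgebra ℂ V :=
  (1 / 2 : ℂ) •
    ∑ i, ExteriorAlgebra.ι ℂ (LinearMap.BilinForm.dualBasis ω hω b i) * ExteriorAlgebra.ι ℂ (b i)

/-- The center `Z ⊆ ⋀^p V`, `V = ℂ^{m+p}`, is self-adjoint: `dim V = 2 p`, and `Z` contains
`θ ∧ ⋀^{p-2} V` for some symplectic structure `ω` on `V` with dual form `θ`. The second condition
is void if `p < 2`. -/
def IsSelfAdjointCenter {m p : ℕ} (Z : Submodule ℂ (⋀[ℂ]^p (Fin m ⊕ Fin p → ℂ))) : Prop :=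
  Module.finrank ℂ (Fin m ⊕ Fin p → ℂ) = 2 * p ∧
    ∃ (ω : LinearMap.BilinForm ℂ (Fin m ⊕ Fin p → ℂ)) (hω : ω.Nondegenerate), ω.IsAlt ∧
      ∀ z : ⋀[ℂ]^p (Fin m ⊕ Fin p → ℂ),
        (∃ k : ℕ, k + 2 = p ∧ ∃ x : ⋀[ℂ]^k (Fin m ⊕ Fin p → ℂ),
          (z : ExteriorAlgebra ℂ (Fin m ⊕ Fin p → ℂ)) =
            dualTwoForm (Pi.basisFun ℂ (Fin m ⊕ Fin p)) ω hω *
              (x : ExteriorAlgebra ℂ (Fin m ⊕ Fin p → ℂ))) →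
        z ∈ Z

/-- The map `f` is a self-adjoint generalized Wronski map: it is `π_Z` for a center `Z` that is
self-adjoint. -/
def IsSelfAdjointGeneralizedWronskiMap {m p : ℕ} (f : Matrix (Fin m) (Fin p) ℂ → ℂ[X]) : Prop :=
  ∃ Z : Submodule ℂ (⋀[ℂ]^p (Fin m ⊕ Fin p → ℂ)),
    IsGeneralizedWronskiMap f Z ∧ IsSelfAdjointCenter Z

end

/-! Write φ(κ(K)+Z) = c(K)·P(K). Since P(K) is monic of degree N, its coefficient of s^N exhibits c
as a linear functional ℓ of κ(K), a polynomial in K without zeros, hence constant. As P(K) =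
χ_A·det(1 - GK), the functional φ, read over ℂ(s), agrees on the vectors κ(K) with a multiple of v ↦
det(Mv₁, …, Mvₚ) for M = (-G, 1). Graphs determine an alternating map, so the two agree everywhere.

Vanishing on θ ∧ ⋀^(p-2) V then says that the rows of M are isotropic, M D Mᵀ = 0, where D is the
skew matrix of the dual form (`fromCols_isotropic`). The same argument for ℓ, with M = (0, 1), kills
the lower right block of D, so D = (a, b; -bᵀ, 0) with b invertible, and isotropy reads G a Gᵀ - G b
+ bᵀ Gᵀ = 0. A constant feedback removes the quadratic term, and b symmetrizes what is left
(`exists_isSymmetric_of_isotropic`). -/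

open Polynomial

/-! ### Alternating maps on the big cell of the Grassmannian -/

section AlternatingMaps

variable {R W : Type*} [CommRing R] [AddCommGroup W] [Module R W] {m p : ℕ}

/-- An alternating map in `p` vectors of `R^{m+p}` that vanishes on the columns of every block
matrix with `K` above the identity vanishes. -/
theorem AlternatingMap.eq_zero_of_forall_graph (f : (Fin m ⊕ Fin p → R) [⋀^Fin p]→ₗ[R] W)
    (hf : ∀ K : Fin p → Fin m → R, f (fun j => Sum.elim (K j) (Pi.single j 1)) = 0) : f = 0 := by
  -- Column a is (K_a, 0) + (0, e_a). Replacing it by (0, e_a) is the case K_a = 0, so by additivity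
  -- the unit vectors can be dropped one at a time.
  have key : ∀ (s : Finset (Fin p)) (K : Fin p → Fin m → R),
      f (fun j => Sum.elim (K j) (if j ∈ s then 0 else Pi.single j 1)) = 0 := by
    intro s
    induction s using Finset.induction_on with
    | empty => simpa using hf
    | insert a s ha ih =>
      intro K
      have h1 := ih K
      have h2 := ih (Function.update K a 0)
      set v : Fin p → Fin m ⊕ Fin p → R :=
        fun j => Sum.elim (K j) (if j ∈ insert a s then 0 else Pi.single j 1) with hv
      have e1 : (fun j => Sum.elim (K j) (if j ∈ s then 0 else Pi.single j 1)) =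
          Function.update v a (v a + Sum.elim (0 : Fin m → R) (Pi.single a 1)) := by
        funext j
        by_cases hj : j = a
        · subst hj
          ext (i | i) <;> simp [hv, ha, Pi.single_apply]
        · simp [hv, hj]
      have e2 : (fun j => Sum.elim (Function.update K a 0 j)
            (if j ∈ s then 0 else Pi.single j 1)) =
          Function.update v a (Sum.elim (0 : Fin m → R) (Pi.single a 1)) := by
        funext j
        by_cases hj : j = a
        · subst hj
          ext (i | i) <;> simp [ha, Pi.single_apply]
        · simp [hv, hj]
      rw [e1, f.map_update_add, ← e2, h2, add_zero, Function.update_eq_self] at h1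
      exact h1
  refine Module.Basis.ext_alternating (Pi.basisFun R (Fin m ⊕ Fin p)) fun σ hσ => ?_
  -- On a tuple of distinct basis vectors, permute the slots so that each lower unit vector e_j sits
  -- in slot j; `key` then applies.
  obtain ⟨e, he⟩ := Equiv.Perm.exists_extending_pair
    (fun j : {j : Fin p // (σ j).isRight} => j.1)
    (fun j => (σ j.1).getRight j.2) Subtype.val_injective (by
      intro i j hij
      apply Subtype.ext
      apply hσ
      rw [← Sum.inr_getRight (σ i.1) i.2, ← Sum.inr_getRight (σ j.1) j.2]
      exact congrArg _ hij)
  have hperm := f.map_perm (fun i => Pi.basisFun R (Fin m ⊕ Fin p) (σ i)) e.symm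
  have hzero : f ((fun i => Pi.basisFun R (Fin m ⊕ Fin p) (σ i)) ∘ e.symm) = 0 := by
    have := key (Finset.univ.filter fun j => (σ (e.symm j)).isLeft)
      (fun j i => Pi.basisFun R (Fin m ⊕ Fin p) (σ (e.symm j)) (Sum.inl i))
    rw [← this]
    congr 1
    funext j
    rcases hj : σ (e.symm j) with i | i
    · ext (l | l) <;> simp [hj]
    · have h1 := he ⟨e.symm j, by simp [hj]⟩
      simp only [Equiv.apply_symm_apply, hj, Sum.getRight_inr] at h1
      subst h1
      ext (l | l) <;> simp [hj, Pi.single_apply]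
  rw [hzero] at hperm
  have := congrArg (fun w => Equiv.Perm.sign e.symm • w) hperm
  simpa [smul_smul] using this.symm

/-- A complex alternating map without zeros on the columns of the block matrices with `K` above the
identity is constant there. -/
theorem AlternatingMap.graph_eq_of_forall_ne_zero (f : (Fin m ⊕ Fin p → ℂ) [⋀^Fin p]→ₗ[ℂ] ℂ)
    (hf : ∀ K : Fin p → Fin m → ℂ, f (fun j => Sum.elim (K j) (Pi.single j 1)) ≠ 0)
    (K : Fin p → Fin m → ℂ) :
    f (fun j => Sum.elim (K j) (Pi.single j 1)) = f (fun j => Sum.elim 0 (Pi.single j 1)) := by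
  have step : ∀ (K : Fin p → Fin m → ℂ) (a : Fin p),
      f (fun j => Sum.elim (K j) (Pi.single j 1)) =
        f (fun j => Sum.elim (Function.update K a 0 j) (Pi.single j 1)) := by
    intro K a
    set v : Fin p → Fin m ⊕ Fin p → ℂ := fun j => Sum.elim (K j) (Pi.single j 1) with hv
    set x := f (Function.update v a (Sum.elim (K a) 0)) with hx
    set y := f (Function.update v a (Sum.elim 0 (Pi.single a 1))) with hy
    have h : ∀ t : ℂ, f (fun j => Sum.elim (Function.update K a (t • K a) j) (Pi.single j 1)) =
        t * x + y := by
      intro t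
      rw [hx, hy, ← smul_eq_mul, ← f.map_update_smul, ← f.map_update_add]
      congr 1
      funext j
      by_cases hj : j = a
      · subst hj
        ext (i | i) <;> simp [Pi.single_apply]
      · simp [hv, hj]
    -- The value is affine in the scaling t of column a, and would vanish at t = -y/x.
    have hx0 : x = 0 := by
      by_contra hne
      apply hf (Function.update K a ((-y / x) • K a))
      rw [h]
      field_simp
      ring
    have h1 := h 1
    have h0 := h 0
    rw [one_smul, Function.update_eq_self] at h1
    rw [zero_smul] at h0
    rw [h0, hv, h1, hx0]
    ring
  have key : ∀ s : Finset (Fin p), f (fun j => Sum.elim (K j) (Pi.single j 1)) =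
      f (fun j => Sum.elim (if j ∈ s then 0 else K j) (Pi.single j 1)) := by
    intro s
    induction s using Finset.induction_on with
    | empty => simp
    | insert a s ha ih =>
      rw [ih, step _ a]
      congr 1
      funext j
      by_cases hj : j = a <;> simp [hj]
  simpa using key Finset.univ

end AlternatingMaps

/-! ### Determinantal functionals and isotropy -/

/-- The alternating map `v ↦ det (M v₁, …, M vₚ)`, with values in an algebra over the scalars. -/
noncomputable def Matrix.mulVecDet {R F ι : Type*} [CommRing R] [CommRing F] [Algebra R F] [Fintype ι] {p : ℕ}
    (M : Matrix (Fin p) ι F) : (ι → R) [⋀^Fin p]→ₗ[R] F where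
  toFun v := Matrix.detRowAlternating fun j => M.mulVec fun i => algebraMap R F (v j i)
  map_update_add' {inst} v a x y := by
    obtain rfl : inst = instDecidableEqFin p := Subsingleton.elim _ _
    have h : ∀ z : ι → R, (fun j => M.mulVec fun i => algebraMap R F (Function.update v a z j i)) =
        Function.update (fun j => M.mulVec fun i => algebraMap R F (v j i)) a
          (M.mulVec fun i => algebraMap R F (z i)) := by
      intro z
      funext j
      by_cases hj : j = a
      · subst hj; simp
      · simp [hj]
    simp only [h]
    rw [← AlternatingMap.map_update_add, ← Matrix.mulVec_add]
    congr 3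
    funext i
    simp
  map_update_smul' {inst} v a c x := by
    obtain rfl : inst = instDecidableEqFin p := Subsingleton.elim _ _
    have h : ∀ z : ι → R, (fun j => M.mulVec fun i => algebraMap R F (Function.update v a z j i)) =
        Function.update (fun j => M.mulVec fun i => algebraMap R F (v j i)) a
          (M.mulVec fun i => algebraMap R F (z i)) := by
      intro z
      funext j
      by_cases hj : j = a
      · subst hj; simp
      · simp [hj]
    simp only [h]
    rw [← algebraMap_smul F c (Matrix.detRowAlternating _), ← AlternatingMap.map_update_smul, ← Matrix.mulVec_smul]
    congr 3
    funext i
    simp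
  map_eq_zero_of_eq' v i j hij hne :=
    AlternatingMap.map_eq_zero_of_eq _ _ (by rw [hij]) hne

theorem Matrix.mulVecDet_apply {R F ι : Type*} [CommRing R] [CommRing F] [Algebra R F] [Fintype ι]
    {p : ℕ} (M : Matrix (Fin p) ι F) (v : Fin p → ι → R) :
    M.mulVecDet v = Matrix.detRowAlternating fun j => M.mulVec fun i => algebraMap R F (v j i) :=
  rfl

/-- The determinant with rows `x`, `y` and all the unit vectors but two. -/
theorem Matrix.det_cons_cons_single {F : Type*} [CommRing F] {k : ℕ} (x y : Fin (k + 2) → F)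
    (σ : Equiv.Perm (Fin (k + 2))) :
    Matrix.detRowAlternating (Fin.cons x (Fin.cons y fun j : Fin k =>
      Pi.single (σ j.succ.succ) 1) : Fin (k + 2) → Fin (k + 2) → F) =
      ((Equiv.Perm.sign σ : ℤ) : F) * (x (σ 0) * y (σ 1) - x (σ 1) * y (σ 0)) := by
  set A : Matrix (Fin (k + 2)) (Fin (k + 2)) F := Matrix.of (Fin.cons x (Fin.cons y fun j : Fin k =>
      Pi.single (σ j.succ.succ) 1) : Fin (k + 2) → Fin (k + 2) → F) with hA
  change A.det = _
  have h1 := Matrix.det_permute' σ A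
  -- Splitting off the first two indices makes the column-permuted matrix block upper triangular,
  -- with an identity as its last block.
  let e : Fin 2 ⊕ Fin k ≃ Fin (k + 2) := finSumFinEquiv.trans (finCongr (Nat.add_comm 2 k))
  have e0 : e (Sum.inl 0) = 0 := by ext; simp [e]
  have e1 : e (Sum.inl 1) = 1 := by ext; simp [e]
  have er : ∀ j, e (Sum.inr j) = j.succ.succ := by intro j; ext; simp [e]
  have h2 : (A.submatrix id σ).det = x (σ 0) * y (σ 1) - x (σ 1) * y (σ 0) := by
    rw [← Matrix.det_submatrix_equiv_self e, ← Matrix.fromBlocks_toBlocks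
      ((A.submatrix id σ).submatrix e e)]
    have h21 : ((A.submatrix id σ).submatrix e e).toBlocks₂₁ = 0 := by
      ext i j
      fin_cases j
      · simp [Matrix.toBlocks₂₁, er, e0, hA, Pi.single_apply, Fin.ext_iff]
      · simp [Matrix.toBlocks₂₁, er, e1, hA, Pi.single_apply, Fin.ext_iff]
    have h22 : ((A.submatrix id σ).submatrix e e).toBlocks₂₂ = 1 := by
      ext i j
      simp [Matrix.toBlocks₂₂, er, hA, Pi.single_apply, Matrix.one_apply, eq_comm]
    rw [h21, h22, Matrix.det_fromBlocks_zero₂₁, Matrix.det_one, mul_one, Matrix.det_fin_two]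
    simp [Matrix.toBlocks₁₁, e0, e1, hA]
  rw [h2] at h1
  rw [h1, ← mul_assoc, ← Int.cast_mul, Int.units_coe_mul_self, Int.cast_one, one_mul]

/-- If `∑ᵢ det (M dᵢ, M eᵢ, M v₃, …, M vₚ)` vanishes for all `v₃, …, vₚ`, where `dᵢ` are the rows of
a skew-symmetric matrix `D`, then `M Dᵀ Mᵀ = 0`. -/
theorem Matrix.mul_mul_transpose_eq_zero_of_mulVecDet {F : Type*} [Field F] [Algebra ℂ F]
    {m p : ℕ} (G : Matrix (Fin p) (Fin m) F)
    (D : Matrix (Fin m ⊕ Fin p) (Fin m ⊕ Fin p) ℂ) (hD : D.transpose = -D)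
    (h : ∀ k, ∀ hk : k + 2 = p, ∀ v : Fin k → Fin m ⊕ Fin p → ℂ,
      ∑ i, (Matrix.fromCols G 1).mulVecDet (fun j => (Fin.cons (D i) (Fin.cons (Pi.single i 1) v) :
        Fin (k + 2) → Fin m ⊕ Fin p → ℂ) (Fin.cast hk.symm j)) = 0) :
    Matrix.fromCols G (1 : Matrix (Fin p) (Fin p) F) * D.map (algebraMap ℂ F) *
      (Matrix.fromCols G (1 : Matrix (Fin p) (Fin p) F)).transpose = 0 := by
  set M := Matrix.fromCols G (1 : Matrix (Fin p) (Fin p) F) with hM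
  set X := M * D.map (algebraMap ℂ F) * M.transpose with hX
  have hXt : X.transpose = -X := by
    rw [hX, Matrix.transpose_mul, Matrix.transpose_mul, Matrix.transpose_transpose,
      ← Matrix.transpose_map, hD, ← Matrix.mul_assoc]
    have : (-D).map (algebraMap ℂ F) = -D.map (algebraMap ℂ F) := by ext; simp
    rw [this]
    simp
  have hchar : (2 : F) ≠ 0 := by
    have : (algebraMap ℂ F) 2 ≠ 0 := by simp
    rwa [map_ofNat] at this
  have hskew : ∀ a b, X b a = -X a b := fun a b => congrFun (congrFun hXt a) b
  have hdiag : ∀ a, X a a = 0 := by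
    intro a
    have h1 : 2 * X a a = 0 := by linear_combination hskew a a
    exact (mul_eq_zero.mp h1).resolve_left hchar
  ext a b
  rw [Matrix.zero_apply]
  by_cases hab : a = b
  · rw [hab]; exact hdiag b
  obtain ⟨k, rfl⟩ : ∃ k, p = k + 2 := by
    have ha := a.2
    have hb := b.2
    have : a.1 ≠ b.1 := fun h => hab (Fin.ext h)
    exact ⟨p - 2, by omega⟩
  -- M sends the lower unit vectors to unit vectors. Taking as v all of them except numbers a and b
  -- reduces each determinant to a 2×2 minor in positions a, b; the minors sum to X b a - X a b = -2
  -- X a b.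
  obtain ⟨σ, hσ⟩ := Equiv.Perm.exists_extending_pair ![(0 : Fin (k + 2)), 1] ![a, b]
    (by intro i j; fin_cases i <;> fin_cases j <;> simp)
    (by intro i j; fin_cases i <;> fin_cases j <;> simp [hab, Ne.symm hab])
  have hσ0 : σ 0 = a := hσ 0
  have hσ1 : σ 1 = b := hσ 1
  have hsum := h k rfl fun j => Pi.single (Sum.inr (σ j.succ.succ)) 1
  have hterm : ∀ i, M.mulVecDet (fun j => (Fin.cons (D i) (Fin.cons (Pi.single i 1)
      fun j => Pi.single (Sum.inr (σ j.succ.succ)) 1) :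
        Fin (k + 2) → Fin m ⊕ Fin (k + 2) → ℂ) (Fin.cast rfl j)) =
      ((Equiv.Perm.sign σ : ℤ) : F) * ((M.mulVec fun l => algebraMap ℂ F (D i l)) a * M b i -
        (M.mulVec fun l => algebraMap ℂ F (D i l)) b * M a i) := by
    intro i
    have hs : ∀ l : Fin m ⊕ Fin (k + 2), (fun i' => algebraMap ℂ F
        ((Pi.single l 1 : Fin m ⊕ Fin (k + 2) → ℂ) i')) = Pi.single l 1 := by
      intro l
      funext i'
      by_cases hl : i' = l
      · subst hl; simp
      · simp [hl]
    have hdet := Matrix.det_cons_cons_single (M.mulVec fun l => algebraMap ℂ F (D i l))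
      (M.mulVec (Pi.single i 1)) σ
    rw [hσ0, hσ1] at hdet
    rw [Matrix.mulVecDet_apply]
    simp only [Matrix.mulVec_single_one, Matrix.col_apply] at hdet
    rw [← hdet]
    congr 1
    funext j
    refine Fin.cases ?_ (fun j => Fin.cases ?_ (fun j => ?_) j) j
    · simp
    · simp only [Fin.cast_eq_self, Fin.cons_succ, Fin.cons_zero, hs, Matrix.mulVec_single_one]
    · simp only [Fin.cast_eq_self, Fin.cons_succ, hs, Matrix.mulVec_single_one]
      ext l
      simp [hM, Matrix.one_apply, Pi.single_apply]
  rw [Finset.sum_congr rfl fun i _ => hterm i, ← Finset.mul_sum] at hsum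
  have hsign : ((Equiv.Perm.sign σ : ℤ) : F) ≠ 0 := by
    rcases Int.units_eq_one_or (Equiv.Perm.sign σ) with h | h <;> simp [h]
  have hXsum : ∀ a b, X b a = ∑ i, (M.mulVec fun l => algebraMap ℂ F (D i l)) a * M b i := by
    intro a b
    simp only [hX, Matrix.mul_assoc, Matrix.mul_apply (M := M), mul_comm (M b _)]
    refine Finset.sum_congr rfl fun i _ => ?_
    congr 1
    simp [Matrix.mul_apply, Matrix.mulVec, dotProduct, mul_comm]
  have h3 := (mul_eq_zero.mp hsum).resolve_left hsign
  rw [Finset.sum_sub_distrib, ← hXsum, ← hXsum, hskew a b] at h3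
  have h4 : 2 * X a b = 0 := by linear_combination -h3
  exact (mul_eq_zero.mp h4).resolve_left hchar

/-- The matrix (G, 1) sends the column (K_j, e_j) to e_j + G K_j. -/
theorem Matrix.fromCols_one_mulVec_graph {F : Type*} [Field F] [Algebra ℂ F] {m p : ℕ}
    (G : Matrix (Fin p) (Fin m) F) (K : Fin p → Fin m → ℂ) :
    (Matrix.fromCols G 1).mulVecDet (fun j => Sum.elim (K j) (Pi.single j (1 : ℂ))) =
      (1 + G * (Matrix.of fun i j => algebraMap ℂ F (K j i))).det := by
  rw [Matrix.mulVecDet_apply, ← Matrix.det_transpose]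
  change Matrix.det _ = _
  congr 1
  ext i j
  simp [Matrix.mulVec, dotProduct, Matrix.mul_apply, Matrix.one_apply, Pi.single_apply,
    add_comm]

/-- A functional on `⋀^p V` that is a constant multiple of `det (1 + G K)` at the Plücker vectors
and vanishes on `θ ∧ ⋀^(p-2) V` makes the rows of `(G, 1)` isotropic for the dual form. -/
theorem fromCols_isotropic {F : Type*} [Field F] [Algebra ℂ F]
    {m p : ℕ} (G : Matrix (Fin p) (Fin m) F)
    (ω : LinearMap.BilinForm ℂ (Fin m ⊕ Fin p → ℂ)) (hω : ω.Nondegenerate)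
    (D : Matrix (Fin m ⊕ Fin p) (Fin m ⊕ Fin p) ℂ) (hDt : D.transpose = -D)
    (hD : ∀ i, D i = LinearMap.BilinForm.dualBasis ω hω (Pi.basisFun ℂ _) i)
    (Ψ : ⋀[ℂ]^p (Fin m ⊕ Fin p → ℂ) →ₗ[ℂ] F) (u : F) (hu : u ≠ 0)
    (hΨ : ∀ K, Ψ (feedbackPlucker K) = u * (1 + G * K.map (algebraMap ℂ F)).det)
    (hθ : ∀ z : ⋀[ℂ]^p (Fin m ⊕ Fin p → ℂ),
        (∃ k : ℕ, k + 2 = p ∧ ∃ x : ⋀[ℂ]^k (Fin m ⊕ Fin p → ℂ),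
          (z : ExteriorAlgebra ℂ (Fin m ⊕ Fin p → ℂ)) =
            dualTwoForm (Pi.basisFun ℂ (Fin m ⊕ Fin p)) ω hω *
              (x : ExteriorAlgebra ℂ (Fin m ⊕ Fin p → ℂ))) → Ψ z = 0) :
    Matrix.fromCols G (1 : Matrix (Fin p) (Fin p) F) * D.map (algebraMap ℂ F) *
      (Matrix.fromCols G (1 : Matrix (Fin p) (Fin p) F)).transpose = 0 := by
  have hone : ∀ j : Fin p, (fun i => (1 : Matrix (Fin p) (Fin p) ℂ) i j) = Pi.single j 1 := by
    intro j
    ext i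
    simp [Matrix.one_apply, Pi.single_apply]
  have hext : Ψ.compAlternatingMap (exteriorPower.ιMulti ℂ p) =
      (LinearMap.mulLeft ℂ u).compAlternatingMap (Matrix.fromCols G 1).mulVecDet := by
    rw [← sub_eq_zero]
    refine AlternatingMap.eq_zero_of_forall_graph _ fun K => ?_
    have h := hΨ (Matrix.of fun i j => K j i)
    simp only [feedbackPlucker, hone, Matrix.of_apply] at h
    rw [AlternatingMap.sub_apply, LinearMap.compAlternatingMap_apply,
      LinearMap.compAlternatingMap_apply, LinearMap.mulLeft_apply,
      Matrix.fromCols_one_mulVec_graph, h, sub_eq_zero]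
    rfl
  refine Matrix.mul_mul_transpose_eq_zero_of_mulVecDet G D hDt ?_
  rintro k rfl v
  have h := hθ ((1 / 2 : ℂ) • ∑ i, exteriorPower.ιMulti ℂ (k + 2)
    (Fin.cons (D i) (Fin.cons (Pi.single i 1) v))) ⟨k, rfl, exteriorPower.ιMulti ℂ k v, by
      simp only [Submodule.coe_smul, Submodule.coe_sum, exteriorPower.ιMulti_apply_coe,
        ExteriorAlgebra.ιMulti_succ_apply, dualTwoForm, smul_mul_assoc, Finset.sum_mul, mul_assoc]
      congr 1
      refine Finset.sum_congr rfl fun i _ => ?_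
      rw [← hD]
      simp [Matrix.vecTail, Function.comp_def]⟩
  rw [map_smul, map_sum] at h
  have h' := (smul_eq_zero.mp h).resolve_left (by norm_num)
  have h2 : ∀ w, Ψ (exteriorPower.ιMulti ℂ (k + 2) w) = u * (Matrix.fromCols G 1).mulVecDet w :=
    fun w => congrArg (fun f => f w) hext
  simp only [h2, ← Finset.mul_sum] at h'
  simpa using (mul_eq_zero.mp h').resolve_left hu

/-- The coordinate matrix of the dual basis of a symplectic form is skew-symmetric and
invertible. -/
theorem dualBasis_matrix {ι : Type*} [Fintype ι] [DecidableEq ι]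
    (ω : LinearMap.BilinForm ℂ (ι → ℂ)) (hω : ω.Nondegenerate) (hA : ω.IsAlt)
    (D : Matrix ι ι ℂ)
    (hD : ∀ i, D i = LinearMap.BilinForm.dualBasis ω hω (Pi.basisFun ℂ _) i) :
    D.transpose = -D ∧ IsUnit D := by
  set Ω : Matrix ι ι ℂ := Matrix.of fun i j => ω (Pi.single i 1) (Pi.single j 1) with hΩ
  -- D is the inverse of the Gram matrix of ω, and inverses of skew matrices are skew.
  have h1 : D * Ω = 1 := by
    ext i j
    have h := LinearMap.BilinForm.apply_dualBasis_left hω (Pi.basisFun ℂ ι) i j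
    rw [← hD, ← (Pi.basisFun ℂ ι).sum_repr (D i), map_sum, LinearMap.sum_apply] at h
    simpa [Matrix.mul_apply, hΩ, Matrix.one_apply, eq_comm] using h
  have h2 : Ω.transpose = -Ω := by
    ext i j
    simp [hΩ, hA.neg_eq]
  have h3 : Ω * D = 1 := mul_eq_one_comm.mp h1
  refine ⟨?_, IsUnit.of_mul_eq_one _ h1⟩
  have h4 : D.transpose * -Ω = 1 := by
    rw [← h2, ← Matrix.transpose_mul, h3, Matrix.transpose_one]
  calc D.transpose = D.transpose * -Ω * -D := by
        rw [Matrix.mul_assoc, neg_mul_neg, h3, Matrix.mul_one]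
    _ = -D := by rw [h4, Matrix.one_mul]

/-! ### Transfer functions and feedback over ℂ(s) -/

theorem Matrix.map_charpoly_ratFunc {n : Type*} [Fintype n] [DecidableEq n] (A : Matrix n n ℂ) :
    algebraMap ℂ[X] (RatFunc ℂ) A.charpoly =
      (Matrix.scalar n (RatFunc.X : RatFunc ℂ) - A.map (algebraMap ℂ (RatFunc ℂ))).det := by
  rw [Matrix.charpoly, RingHom.map_det]
  congr 1
  ext i j
  by_cases hij : i = j
  · subst hij
    simp [Matrix.charmatrix]
  · simp [Matrix.charmatrix, hij]

theorem Matrix.isUnit_det_scalar_X_sub {n : Type*} [Fintype n] [DecidableEq n]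
    (A : Matrix n n ℂ) :
    IsUnit (Matrix.scalar n (RatFunc.X : RatFunc ℂ) - A.map (algebraMap ℂ (RatFunc ℂ))).det := by
  rw [← Matrix.map_charpoly_ratFunc, isUnit_iff_ne_zero, Ne,
    FaithfulSMul.algebraMap_eq_zero_iff]
  exact A.charpoly_monic.ne_zero

namespace LinearSystem

variable {N m p : ℕ}

/-- With R = sI - A, factor R - BKC = R(1 - R⁻¹BKC) and use det(1 - XY) = det(1 - YX) to pass to a p
× p determinant. -/
theorem map_polePlacementMap (S : LinearSystem N m p) (K : Matrix (Fin m) (Fin p) ℂ) :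
    algebraMap ℂ[X] (RatFunc ℂ) (S.polePlacementMap K) =
      algebraMap ℂ[X] (RatFunc ℂ) S.A.charpoly *
        (1 + -S.transferFunction * K.map (algebraMap ℂ (RatFunc ℂ))).det := by
  have hR := Matrix.isUnit_det_scalar_X_sub S.A
  rw [polePlacementMap, Matrix.map_charpoly_ratFunc, Matrix.map_charpoly_ratFunc,
    transferFunction]
  set R := Matrix.scalar (Fin N) (RatFunc.X : RatFunc ℂ) - S.A.map (algebraMap ℂ (RatFunc ℂ))
    with hRdef
  rw [Matrix.neg_mul, ← sub_eq_add_neg, Matrix.mul_assoc (S.C.map _), Matrix.mul_assoc (S.C.map _),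
    Matrix.det_one_sub_mul_comm, ← Matrix.det_mul, Matrix.mul_sub, Matrix.mul_one,
    Matrix.mul_assoc R⁻¹, Matrix.mul_assoc R⁻¹, Matrix.mul_nonsing_inv_cancel_left _ _ hR, hRdef,
    Matrix.map_add _ (map_add _), Matrix.map_mul, Matrix.map_mul, sub_add_eq_sub_sub]

/-- The transfer function `G'` of the closed loop system satisfies `G' = (1 + G' K) G`. -/
theorem transferFunction_feedback (S : LinearSystem N m p) (K : Matrix (Fin m) (Fin p) ℂ) :
    (LinearSystem.mk (S.A + S.B * K * S.C) S.B S.C).transferFunction =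
      (1 + (LinearSystem.mk (S.A + S.B * K * S.C) S.B S.C).transferFunction *
        K.map (algebraMap ℂ (RatFunc ℂ))) * S.transferFunction := by
  have hR := Matrix.isUnit_det_scalar_X_sub S.A
  have hR' := Matrix.isUnit_det_scalar_X_sub (S.A + S.B * K * S.C)
  simp only [transferFunction]
  set R := Matrix.scalar (Fin N) (RatFunc.X : RatFunc ℂ) - S.A.map (algebraMap ℂ (RatFunc ℂ))
    with hRdef
  set R' := Matrix.scalar (Fin N) (RatFunc.X : RatFunc ℂ) -
    (S.A + S.B * K * S.C).map (algebraMap ℂ (RatFunc ℂ)) with hRdef'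
  have hRR : R' = R - S.B.map (algebraMap ℂ (RatFunc ℂ)) * K.map (algebraMap ℂ (RatFunc ℂ)) *
      S.C.map (algebraMap ℂ (RatFunc ℂ)) := by
    rw [hRdef, hRdef', Matrix.map_add _ (map_add _), Matrix.map_mul, Matrix.map_mul,
      sub_add_eq_sub_sub]
  -- The resolvent identity R'⁻¹ = R⁻¹ + R'⁻¹(R - R')R⁻¹.
  have hinv : R'⁻¹ = R⁻¹ + R'⁻¹ * (S.B.map (algebraMap ℂ (RatFunc ℂ)) *
      K.map (algebraMap ℂ (RatFunc ℂ)) * S.C.map (algebraMap ℂ (RatFunc ℂ))) * R⁻¹ := by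
    have : S.B.map (algebraMap ℂ (RatFunc ℂ)) * K.map (algebraMap ℂ (RatFunc ℂ)) *
      S.C.map (algebraMap ℂ (RatFunc ℂ)) = R - R' := by rw [hRR]; abel
    rw [this, Matrix.mul_sub, Matrix.nonsing_inv_mul _ hR', Matrix.sub_mul, Matrix.one_mul,
      Matrix.mul_nonsing_inv_cancel_right _ _ hR]
    abel
  conv_lhs => rw [hinv]
  simp only [Matrix.mul_add, Matrix.add_mul, Matrix.one_mul, Matrix.mul_assoc]

theorem transferFunction_input (A : Matrix (Fin N) (Fin N) ℂ) (B : Matrix (Fin N) (Fin m) ℂ)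
    (C : Matrix (Fin p) (Fin N) ℂ) (W : Matrix (Fin m) (Fin m) ℂ) :
    (LinearSystem.mk A (B * W) C).transferFunction =
      (LinearSystem.mk A B C).transferFunction * W.map (algebraMap ℂ (RatFunc ℂ)) := by
  simp only [transferFunction, Matrix.map_mul, Matrix.mul_assoc]

/-- If the transfer function satisfies `G a Gᵀ - G b + bᵀ Gᵀ = 0` with `a` skew-symmetric and `b`
invertible, then a feedback and a change of the inputs make it symmetric. -/
theorem exists_isSymmetric_of_isotropic (S : LinearSystem N p p) (a b : Matrix (Fin p) (Fin p) ℂ)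
    (ha : a.transpose = -a) (hb : IsUnit b)
    (h : S.transferFunction * a.map (algebraMap ℂ (RatFunc ℂ)) * S.transferFunction.transpose -
      S.transferFunction * b.map (algebraMap ℂ (RatFunc ℂ)) +
      (b.map (algebraMap ℂ (RatFunc ℂ))).transpose * S.transferFunction.transpose = 0) :
    ∃ S' : LinearSystem N p p, S.StateFeedbackEquivalent S' ∧ S'.IsSymmetric := by
  have hbt : IsUnit b.transpose.det := by
    rw [Matrix.det_transpose]; exact (Matrix.isUnit_iff_isUnit_det b).mp hb
  -- Chosen so that K bᵀ = -a/2; as a is skew, this solves a - b Kᵀ + K bᵀ = 0.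
  set K : Matrix (Fin p) (Fin p) ℂ := (-(1 / 2 : ℂ)) • a * b.transpose⁻¹ with hK
  have hKb : K * b.transpose = (-(1 / 2 : ℂ)) • a := Matrix.nonsing_inv_mul_cancel_right _ _ hbt
  have hbK : b * K.transpose = (1 / 2 : ℂ) • a := by
    have := congrArg Matrix.transpose hKb
    rw [Matrix.transpose_mul, Matrix.transpose_transpose, Matrix.transpose_smul, ha] at this
    rw [this]; simp
  have hrel : a - b * K.transpose + K * b.transpose = 0 := by
    rw [hKb, hbK]
    module
  refine ⟨⟨S.A + S.B * K * S.C, S.B * b, S.C⟩, ⟨1, b, 1, K, isUnit_one, hb, isUnit_one,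
    by simp, by simp, by simp⟩, rfl, ?_⟩
  rw [transferFunction_input]
  have hG := S.transferFunction_feedback K
  set G' := (LinearSystem.mk (S.A + S.B * K * S.C) S.B S.C).transferFunction
  set G := S.transferFunction
  set a' := a.map (algebraMap ℂ (RatFunc ℂ))
  set b' := b.map (algebraMap ℂ (RatFunc ℂ))
  set K' := K.map (algebraMap ℂ (RatFunc ℂ))
  have hrel' : a' - b' * K'.transpose + K' * b'.transpose = 0 := by
    have := congrArg (algebraMap ℂ (RatFunc ℂ)).mapMatrix hrel
    rw [map_add, map_sub, map_mul, map_mul, map_zero] at this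
    exact this
  have hsym : G' * b' = (G' * b').transpose := by
    rw [← sub_eq_zero, Matrix.transpose_mul]
    -- Multiplying by 1 + G'K and its transpose turns G into G'; the terms quadratic in G' collect
    -- to G'(a - bKᵀ + Kbᵀ)G'ᵀ = 0.
    have h1 : (1 + G' * K') * (G * a' * G.transpose - G * b' + b'.transpose * G.transpose) *
        (1 + G' * K').transpose = 0 := by rw [h]; simp
    have hGt : G'.transpose = G.transpose * (1 + G' * K').transpose := by
      rw [← Matrix.transpose_mul, ← hG]
    calc G' * b' - b'.transpose * G'.transpose
        = G' * (a' - b' * K'.transpose + K' * b'.transpose) * G'.transpose -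
          (G' * a' * G'.transpose - G' * b' * (1 + G' * K').transpose +
            (1 + G' * K') * b'.transpose * G'.transpose) := by
          rw [Matrix.transpose_add, Matrix.transpose_one, Matrix.transpose_mul]
          noncomm_ring
      _ = 0 := by
          rw [hrel', Matrix.mul_zero, Matrix.zero_mul, zero_sub, neg_eq_zero, ← h1]
          rw [show G' * a' * G'.transpose = (1 + G' * K') * G * a' *
            (G.transpose * (1 + G' * K').transpose) by rw [← hG, ← hGt],
            show G' * b' = (1 + G' * K') * G * b' by rw [← hG], hGt]
          simp only [Matrix.mul_add, Matrix.add_mul, Matrix.mul_sub, Matrix.sub_mul,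
            Matrix.mul_assoc]
  intro i j
  exact congrFun (congrFun hsym i) j

end LinearSystem

/-! ### From the center to a symmetric system -/

theorem mainTheorem8 {N m p : ℕ} (S : LinearSystem N m p)
    (h : IsSelfAdjointGeneralizedWronskiMap S.polePlacementMap) :
    ∃ S' : LinearSystem N m p, S.StateFeedbackEquivalent S' ∧ S'.IsSymmetric := by
  obtain ⟨Z, ⟨φ, -, hφ⟩, hdim, ω, hω, hA, hθ⟩ := h
  obtain rfl : m = p := by
    have : m + p = 2 * p := by simpa using hdim
    omega
  obtain ⟨D, hD⟩ : ∃ D : Matrix (Fin m ⊕ Fin m) (Fin m ⊕ Fin m) ℂ,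
      ∀ i, D i = LinearMap.BilinForm.dualBasis ω hω (Pi.basisFun ℂ _) i := ⟨_, fun _ => rfl⟩
  obtain ⟨hDt, hDu⟩ := dualBasis_matrix ω hω hA D hD
  have hone : ∀ j : Fin m, (fun i => (1 : Matrix (Fin m) (Fin m) ℂ) i j) = Pi.single j 1 := by
    intro j
    ext i
    simp [Matrix.one_apply, Pi.single_apply]
  have hmonic : ∀ K, (S.polePlacementMap K).coeff N = 1 := by
    intro K
    have h1 := (S.A + S.B * K * S.C).charpoly_monic.coeff_natDegree
    rwa [Matrix.charpoly_natDegree_eq_dim, Fintype.card_fin] at h1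
  set ℓ : ⋀[ℂ]^m (Fin m ⊕ Fin m → ℂ) →ₗ[ℂ] ℂ := Polynomial.lcoeff ℂ N ∘ₗ φ ∘ₗ Z.mkQ with hℓ
  have hcoeff : ∀ K c, φ (Z.mkQ (feedbackPlucker K)) = c • S.polePlacementMap K →
      ℓ (feedbackPlucker K) = c := by
    intro K c hc
    simp only [hℓ, LinearMap.comp_apply, hc, Polynomial.lcoeff_apply, Polynomial.coeff_smul,
      hmonic, smul_eq_mul, mul_one]
  have hne : ∀ K, ℓ (feedbackPlucker K) ≠ 0 := by
    intro K
    obtain ⟨c, hc, h1⟩ := hφ K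
    rwa [hcoeff K c h1]
  obtain ⟨c, hc⟩ : ∃ c, ∀ K, ℓ (feedbackPlucker K) = c := by
    refine ⟨ℓ.compAlternatingMap (exteriorPower.ιMulti ℂ m) fun j => Sum.elim 0 (Pi.single j 1),
      fun K => ?_⟩
    have h1 := AlternatingMap.graph_eq_of_forall_ne_zero
      (ℓ.compAlternatingMap (exteriorPower.ιMulti ℂ m)) (fun K => by
        have h2 := hne (Matrix.of fun i j => K j i)
        simp only [feedbackPlucker, hone] at h2
        exact h2) K.transpose
    simp only [feedbackPlucker, hone]
    exact h1
  have hc0 : c ≠ 0 := hc 0 ▸ hne 0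
  have hφ' : ∀ K, φ (Z.mkQ (feedbackPlucker K)) = c • S.polePlacementMap K := by
    intro K
    obtain ⟨c', -, h1⟩ := hφ K
    rwa [← hc K, hcoeff K c' h1]
  have hZ : ∀ z ∈ Z, φ (Z.mkQ z) = 0 := by
    intro z hz
    rw [Submodule.mkQ_apply, (Submodule.Quotient.mk_eq_zero Z).mpr hz, map_zero]
  -- The leading coefficient plays the role of s = ∞, where G vanishes: isotropy of the rows of (0,
  -- 1) is the vanishing of the lower right block.
  have hd := fromCols_isotropic (F := ℂ) (0 : Matrix (Fin m) (Fin m) ℂ) ω hω D hDt hD ℓ c hc0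
    (fun K => by rw [hc K]; simp) (fun z hz => by
      simp only [hℓ, LinearMap.comp_apply, hZ z (hθ z hz), map_zero])
  have hs := fromCols_isotropic (-S.transferFunction) ω hω D hDt hD
    ((Algebra.linearMap ℂ[X] (RatFunc ℂ)).restrictScalars ℂ ∘ₗ φ ∘ₗ Z.mkQ)
    (algebraMap ℂ (RatFunc ℂ) c * algebraMap ℂ[X] (RatFunc ℂ) S.A.charpoly)
    (mul_ne_zero (by simpa using hc0) (by
      simpa using S.A.charpoly_monic.ne_zero))
    (fun K => by
      rw [mul_assoc, ← S.map_polePlacementMap, LinearMap.comp_apply, LinearMap.comp_apply, hφ',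
        map_smul, Algebra.smul_def]
      rfl)
    (fun z hz => by simp only [LinearMap.comp_apply, hZ z (hθ z hz), map_zero])
  obtain ⟨a, b, b', d, rfl⟩ : ∃ a b b' d, D = Matrix.fromBlocks a b b' d :=
    ⟨_, _, _, _, (Matrix.fromBlocks_toBlocks D).symm⟩
  rw [Matrix.fromBlocks_transpose, Matrix.fromBlocks_neg, Matrix.fromBlocks_inj] at hDt
  obtain ⟨hat, hbt, -, -⟩ := hDt
  obtain rfl : b' = -b.transpose := by
    rw [← Matrix.transpose_transpose b', hbt, Matrix.transpose_neg]
  obtain rfl : d = 0 := by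
    simpa [Matrix.fromBlocks_map, Matrix.fromCols_mul_fromBlocks, Matrix.transpose_fromCols,
      Matrix.fromCols_mul_fromRows] using hd
  refine S.exists_isSymmetric_of_isotropic a b hat ?_ ?_
  · have hdet := (Matrix.isUnit_iff_isUnit_det _).mp hDu
    have h1 := Matrix.mul_nonsing_inv _ hdet
    rw [← Matrix.fromBlocks_toBlocks (Matrix.fromBlocks a b (-b.transpose) 0)⁻¹,
      Matrix.fromBlocks_multiply, ← Matrix.fromBlocks_one, Matrix.fromBlocks_inj] at h1
    -- The lower right block of D D⁻¹ = 1 gives a right inverse of bᵀ, because d = 0.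
    have h2 := h1.2.2.2
    rw [Matrix.zero_mul, add_zero, Matrix.neg_mul, ← Matrix.mul_neg] at h2
    exact (Matrix.isUnit_transpose b).mp (IsUnit.of_mul_eq_one _ h2)
  · rw [Matrix.fromBlocks_map, Matrix.fromCols_mul_fromBlocks, Matrix.transpose_fromCols,
      Matrix.fromCols_mul_fromRows] at hs
    have e1 : (-b.transpose).map (algebraMap ℂ (RatFunc ℂ)) =
        -(b.map (algebraMap ℂ (RatFunc ℂ))).transpose := by ext; simp
    have e2 : (0 : Matrix (Fin m) (Fin m) ℂ).map (algebraMap ℂ (RatFunc ℂ)) = 0 := by ext; simp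
    rw [e1, e2] at hs
    rw [← hs]
    simp only [Matrix.transpose_neg, Matrix.transpose_one]
    noncomm_ring
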